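/- Let $d\ge 1$, $n=d+1$, and let $\mathbb P(w_1,\dots,w_n)$ be a $d$-dimensional weighted projective space: $w_1,\dots,w_n$ are positive integers with $\gcd(w_1,\dots,w_n)=1$, and $v_1,\dots,v_n\in M=\mathbb Z^d$ are vectors that generate $M$ and satisfy $w_1v_1+\dots+w_nv_n=0$. Let $\{v_1,\dots,v_n\}=A_1\sqcup\dots\sqcup A_r$ be a decomposition into nonempty subsets, and put $d_j=\sum_{v_k\in A_j}w_k$. (It comes from a nef-partition when $w_k\mid d_j$ for all $k,j$; this is not needed below.) Let $b_1,\dots,b_r$ be the standard basis of $\mathbb Z^r$, let $e_j=(0,b_j)$ and $u_k=(v_k,b_j)$ for $v_k\in A_j$ in $M\oplus\mathbb Z^r$, and let $\widetilde A=\{e_1,\dots,e_r,u_1,\dots,u_n\}$. For $a\in\mathbb C^n$ let $$f_j(t)=1-\sum_{v_k\in A_j}a_kt^{v_k},\qquad F(t)=t_{d+1}f_1(t)+\dots+t_{d+r}f_r(t).$$ For a finite set $A$ of exponents, the $A$-discriminant $D_A\in\mathbb Z[x_\omega:\omega\in A]$ is the irreducible polynomial over $\mathbb Z$ (so its coefficients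 have no common factor), unique up to sign, whose zero set in $\mathbb C^A$ is the Zariski closure of the set of those Laurent polynomials $f=\sum_{\omega\in A}x_\omega t^\omega$ for which $f$ and all its first partial derivatives vanish simultaneously at some point of the torus; $D_A=1$ if this closure is not a hypersurface. $D_A(f)$ is its value at the coefficients of $f$. Put $g=\gcd\bigl(\prod_k w_k^{w_k},\prod_j d_j^{d_j}\bigr)$. Then there is a sign $\varepsilon=\pm1$ such that for all $a\in\mathbb C^n$ $$g\cdot D_{\widetilde A}(F)=\varepsilon\Bigl(\prod_{k=1}^n w_k^{w_k}-\prod_{j=1}^r d_j^{d_j}\prod_{k=1}^n a_k^{w_k}\Bigr)=\varepsilon\prod_{k=1}^n w_k^{w_k}\,(1-\mu y),$$ where $y=\prod_k a_k^{w_k}$ and $\mu=\prod_j d_j^{d_j}/\prod_k w_k^{w_k}$. In other words, up to sign and up to the positive integer factor $g$ that makes the coefficients coprime, the $\widetilde A$-discriminant of $F$ is the binomial. If $w_k\mid d_j$ for all $k,j$ (the case of a nef-partition), then $g=\prod_k w_k^{w_k}$. Moreover, the first summand $\prod_k w_k^{w_k}$ corresponds to the coherent triangulation of $\operatorname{conv}(\widetilde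 A)$ with the simplices $\operatorname{conv}(\widetilde A\setminus\{u_k\})$, $k=1,\dots,n$, and the second summand to the one with the simplices $\operatorname{conv}(\widetilde A\setminus\{e_j\})$, $j=1,\dots,r$. Here a term of $D_{\widetilde A}$ with exponent $m$ corresponds to a coherent triangulation $T$ if $T$ is induced, through the upper hull, by some height function $\psi:\widetilde A\to\mathbb R$, and for every $\psi$ inducing $T$ the linear form $m'\mapsto\sum_\omega\psi(\omega)m'_\omega$ has its strict maximum over the exponents of $D_{\widetilde A}$ at $m$; the summands are the values of $g$ times these terms at the coefficients of $F$ (up to the sign $\varepsilon$). -/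

import Mathlib

open MvPolynomial

noncomputable section

/-! ### The `A`-discriminant of a finite set `A` of exponents -/

section Discriminant

variable {σ : Type*} [Fintype σ] [DecidableEq σ]

/-- The Laurent monomial `t ^ m = ∏ i, t i ^ m i` at a point `t` of the torus `(ℂˣ) ^ σ`. -/
def laurentMonomial (t : σ → ℂˣ) (m : σ → ℤ) : ℂ :=
  ∏ i, (t i : ℂ) ^ m i

/-- The value at `t` of the Laurent polynomial `∑ ω ∈ A, c ω * t ^ ω`. -/
def laurentValue (A : Finset (σ → ℤ)) (c : A → ℂ) (t : σ → ℂˣ) : ℂ :=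
  ∑ ω : A, c ω * laurentMonomial t ω.1

/-- The value at `t` of the partial derivative `∂/∂t_i` of `∑ ω ∈ A, c ω * t ^ ω`. -/
def laurentPartial (A : Finset (σ → ℤ)) (c : A → ℂ) (i : σ) (t : σ → ℂˣ) : ℂ :=
  ∑ ω : A, c ω * (ω.1 i : ℂ) * laurentMonomial t (ω.1 - Pi.single i 1)

/-- The set of all `f ∈ ℂ ^ A` such that `f` and all its first partial derivatives vanish
simultaneously at some point of the torus. -/
def singularLocus (A : Finset (σ → ℤ)) : Set (A → ℂ) :=
  {c | ∃ t : σ → ℂˣ, laurentValue A c t = 0 ∧ ∀ i, laurentPartial A c i t = 0}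

/-- The Zariski closure of the singular locus in the affine space `ℂ ^ A`. -/
def discriminantVariety (A : Finset (σ → ℤ)) : Set (A → ℂ) :=
  zeroLocus ℂ (vanishingIdeal ℂ (singularLocus A))

/-- `D` is an irreducible polynomial over `ℤ` (in particular its coefficients have no common
factor) whose zero set in `ℂ ^ A` is the discriminant variety. Such a `D` exists if and only if
the discriminant variety is a hypersurface, and it is then unique up to sign. -/
def DefinesDiscriminantVariety (A : Finset (σ → ℤ)) (D : MvPolynomial A ℤ) : Prop :=
  Irreducible D ∧ {c : A → ℂ | aeval c D = 0} = discriminantVariety A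

open Classical in
/-- The `A`-discriminant, an element of `ℤ[x_ω : ω ∈ A]` that is determined up to sign; it is `1`
if the discriminant variety is not a hypersurface. -/
def aDiscriminant (A : Finset (σ → ℤ)) : MvPolynomial A ℤ :=
  if h : ∃ D : MvPolynomial A ℤ, DefinesDiscriminantVariety A D then h.choose else 1

/-- The coefficients at the points of `A` of a Laurent polynomial. -/
def coeffsOn (A : Finset (σ → ℤ)) (f : AddMonoidAlgebra ℂ (σ → ℤ)) : A → ℂ :=
  fun ω => f.coeff ω.1

/-- The `A`-discriminant of a Laurent polynomial `f` with exponents in `A`. -/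
def aDiscriminantOf (A : Finset (σ → ℤ)) (f : AddMonoidAlgebra ℂ (σ → ℤ)) : ℂ :=
  aeval (coeffsOn A f) (aDiscriminant A)

/-! ### Coherent triangulations -/

/-- `S ⊆ A` is a cell of the coherent subdivision of `(conv A, A)` induced by the heights `ψ`:
the points of `S` are those lifted onto some supporting hyperplane of the upper hull. -/
def IsCell (A : Finset (σ → ℤ)) (ψ : A → ℝ) (S : Set A) : Prop :=
  ∃ l : (σ → ℝ) →ᵃ[ℝ] ℝ,
    (∀ ω : A, ψ ω ≤ l (fun i => (ω.1 i : ℝ))) ∧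
      S = {ω : A | l (fun i => (ω.1 i : ℝ)) = ψ ω}

/-- The heights `ψ` induce the triangulation whose maximal simplices are the convex hulls of the
members of `T`. -/
def InducesTriangulation (A : Finset (σ → ℤ)) (ψ : A → ℝ) (T : Set (Set A)) : Prop :=
  {S | Maximal (IsCell A ψ) S} = T ∧
    ∀ S ∈ T, AffineIndependent ℝ (fun ω : S => fun i => (ω.1.1 i : ℝ))

/-- The exponent `m` of the polynomial `D` corresponds to the coherent triangulation `T`: it is the
vertex of the Newton polytope of `D` at which every `ψ` inducing `T` attains its maximum (and
attains it only there). -/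
def CorrespondsToTriangulation (A : Finset (σ → ℤ)) (D : MvPolynomial A ℤ) (m : A →₀ ℕ)
    (T : Set (Set A)) : Prop :=
  m ∈ D.support ∧ (∃ ψ, InducesTriangulation A ψ T) ∧
    ∀ ψ, InducesTriangulation A ψ T → ∀ m' ∈ D.support, m' ≠ m →
      ∑ ω, ψ ω * (m' ω : ℝ) < ∑ ω, ψ ω * (m ω : ℝ)

end Discriminant

/-! ### The Cayley configuration of a partition of the rays of a weighted projective space

The map `p : Fin n → Fin r` encodes the decomposition of `v_1, …, v_n` into
`A_j = {v_k : p k = j}`. The lattice `M ⊕ ℤ ^ r` with `M = ℤ ^ d` is `Fin d ⊕ Fin r → ℤ`. -/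

section Cayley

variable {n d r : ℕ}

/-- The point `e_j = (0, b_j)`. -/
def cayleyE (d : ℕ) {r : ℕ} (j : Fin r) : Fin d ⊕ Fin r → ℤ :=
  Sum.elim 0 (Pi.single j 1)

/-- The point `u_k = (v_k, b_j)`, where `v_k ∈ A_j`. -/
def cayleyU (v : Fin n → Fin d → ℤ) (p : Fin n → Fin r) (k : Fin n) : Fin d ⊕ Fin r → ℤ :=
  Sum.elim (v k) (Pi.single (p k) 1)

/-- The set `{e_1, …, e_r, u_1, …, u_n}`. -/
def cayleySet (v : Fin n → Fin d → ℤ) (p : Fin n → Fin r) : Finset (Fin d ⊕ Fin r → ℤ) :=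
  Finset.univ.image (cayleyE d) ∪ Finset.univ.image (cayleyU v p)

/-- `d_j = ∑_{v_k ∈ A_j} w_k`. -/
def partDegree (w : Fin n → ℕ) (p : Fin n → Fin r) (j : Fin r) : ℕ :=
  ∑ k with p k = j, w k

/-- The Laurent polynomial `f_j(t) = 1 - ∑_{v_k ∈ A_j} a_k t ^ v_k`. -/
def cayleyF (v : Fin n → Fin d → ℤ) (p : Fin n → Fin r) (a : Fin n → ℂ) (j : Fin r) :
    AddMonoidAlgebra ℂ (Fin d → ℤ) :=
  1 - ∑ k with p k = j, AddMonoidAlgebra.single (v k) (a k)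

/-- The Cayley polynomial `F(t) = t_{d+1} f_1(t) + ⋯ + t_{d+r} f_r(t)`. -/
def cayleyPolynomial (v : Fin n → Fin d → ℤ) (p : Fin n → Fin r) (a : Fin n → ℂ) :
    AddMonoidAlgebra ℂ (Fin d ⊕ Fin r → ℤ) :=
  ∑ j, AddMonoidAlgebra.single (cayleyE d j) (1 : ℂ) *
    AddMonoidAlgebra.mapDomain (fun m : Fin d → ℤ => Sum.elim m (0 : Fin r → ℤ))
      (cayleyF v p a j)

/-- The triangulation with the simplices `conv (Ã \ {e_j})`, `j = 1, …, r`. -/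
def triangulationE (v : Fin n → Fin d → ℤ) (p : Fin n → Fin r) : Set (Set (cayleySet v p)) :=
  Set.range fun j : Fin r => {ω | ω.1 ≠ cayleyE d j}

/-- The triangulation with the simplices `conv (Ã \ {u_k})`, `k = 1, …, n`. -/
def triangulationU (v : Fin n → Fin d → ℤ) (p : Fin n → Fin r) : Set (Set (cayleySet v p)) :=
  Set.range fun k : Fin n => {ω | ω.1 ≠ cayleyU v p k}

end Cayley

end

/-! The points of `Ã` form a circuit: they generate the lattice, and all their integral relations
are multiples of `∑ w_k u_k = ∑ d_j e_j` (`isPrimitiveCircuit_cayleySet`). Everything else holds for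
a circuit `A` with primitive affine relation `κ`.

If `f` is singular at `t`, then `(c_ω t ^ ω)` is a linear relation on `A`, hence `l κ`. Conversely,
every point `(κ_ω t ^ ω)` is singular. So the discriminant variety is a translated toric
hypersurface, and its equation generates the kernel of `x_ω ↦ κ_ω t ^ ω`. Since `κ` is primitive,
reduction modulo `a x ^ κ⁺ - b x ^ κ⁻` leaves monomials with distinct images, so this binomial
generates the kernel up to integer factors; when `a` and `b` are coprime it does so over `ℤ` and is
prime (`IsPrimitiveCircuit.circuitBinomial_dvd`, `IsPrimitiveCircuit.aDiscriminant_eq`).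

Heights `ψ` induce the triangulation that omits the points with `κ > 0` one at a time exactly when
`∑ κ_ω ψ_ω < 0`. This sum is also the difference of the values of the linear form `ψ` at `κ⁺` and
`κ⁻`, which matches exponents with triangulations. -/

noncomputable section

/-! ### Primitive circuits and their binomial ideal. -/

section Circuit

variable {σ : Type*} {A : Finset (σ → ℤ)} {κ : A → ℤ}

/-- `A` generates the lattice `ℤ ^ σ`, and the integral linear relations between the points of `A`
are the multiples of the relation `κ`, which is affine and has no vanishing coefficient. -/
structure IsPrimitiveCircuit (A : Finset (σ → ℤ)) (κ : A → ℤ) : Prop where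
  nonempty : Nonempty A
  ne_zero : ∀ ω, κ ω ≠ 0
  sum_eq_zero : ∑ ω, κ ω = 0
  relation : ∑ ω : A, κ ω • ω.1 = 0
  unique : ∀ z : A → ℤ, ∑ ω : A, z ω • ω.1 = 0 → ∃ c : ℤ, ∀ ω, z ω = c * κ ω
  generates : ∀ y : σ → ℤ, ∃ z : A → ℤ, ∑ ω : A, z ω • ω.1 = y

theorem IsPrimitiveCircuit.neg (h : IsPrimitiveCircuit A κ) : IsPrimitiveCircuit A (-κ) where
  nonempty := h.nonempty
  ne_zero ω := by simpa using h.ne_zero ω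
  sum_eq_zero := by simp only [Pi.neg_apply, Finset.sum_neg_distrib, h.sum_eq_zero, neg_zero]
  relation := by
    simp only [Pi.neg_apply, neg_smul, Finset.sum_neg_distrib, h.relation, neg_zero]
  unique z hz := by
    obtain ⟨c, hc⟩ := h.unique z hz
    exact ⟨-c, fun ω => by simp [hc]⟩
  generates := h.generates

theorem IsPrimitiveCircuit.exists_pos (h : IsPrimitiveCircuit A κ) : ∃ ω, 0 < κ ω := by
  by_contra! hneg
  have := (Finset.sum_eq_zero_iff_of_nonpos fun ω _ => hneg ω).1 h.sum_eq_zero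
  obtain ⟨ω⟩ := h.nonempty
  exact h.ne_zero ω (this ω (Finset.mem_univ _))

/-- A function on a primitive circuit with values in an abelian group that satisfies the relation
is the restriction of a homomorphism. -/
theorem IsPrimitiveCircuit.exists_extension [Fintype σ] (h : IsPrimitiveCircuit A κ) {G : Type*}
    [AddCommGroup G] (x : A → G) (hx : ∑ ω, κ ω • x ω = 0) :
    ∃ s : σ → G, ∀ ω : A, x ω = ∑ i, ω.1 i • s i := by
  classical
  choose z hz using fun i : σ => h.generates (Pi.single i 1)
  refine ⟨fun i => ∑ ω, z i ω • x ω, fun ω₀ => ?_⟩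
  -- Expanding `ω₀` in the unit vectors, and these in `A`, gives a second expression for `ω₀`. Its
  -- difference from the trivial one is a multiple of `κ`, which `x` kills.
  obtain ⟨c, hc⟩ := h.unique (fun ω =>
      Pi.single (M := fun _ : A => ℤ) ω₀ 1 ω - ∑ i, ω₀.1 i * z i ω) (by
    simp only [sub_smul, Finset.sum_sub_distrib, Finset.sum_smul, mul_smul]
    rw [Finset.sum_comm]
    simp only [← Finset.smul_sum, hz]
    rw [Finset.sum_eq_single ω₀ (by intro b _ hb; simp [hb]) (by simp)]
    ext i
    simp [Finset.sum_apply, Pi.single_apply])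
  have h1 : ∑ ω, (Pi.single (M := fun _ : A => ℤ) ω₀ 1 ω - ∑ i, ω₀.1 i * z i ω) • x ω = 0 := by
    simp only [hc, mul_smul, ← Finset.smul_sum, hx, smul_zero]
  simp only [sub_smul, Finset.sum_sub_distrib, Finset.sum_smul, mul_smul] at h1
  rw [Finset.sum_comm, Finset.sum_eq_single ω₀ (by intro b _ hb; simp [hb]) (by simp)] at h1
  simp only [← Finset.smul_sum] at h1
  simpa [sub_eq_zero] using h1

/-- The exponent with the positive coefficients of `κ`. -/
def posExponent (κ : A → ℤ) : A →₀ ℕ := Finsupp.equivFunOnFinite.symm fun ω => (κ ω).toNat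

@[simp]
theorem posExponent_apply (κ : A → ℤ) (ω : A) : posExponent κ ω = (κ ω).toNat := rfl

/-- The binomial `a x ^ κ⁺ - b x ^ κ⁻`. -/
def circuitBinomial (K : Type*) [CommRing K] (κ : A → ℤ) (a b : ℤ) : MvPolynomial A K :=
  monomial (posExponent κ) (a : K) - monomial (posExponent (-κ)) (b : K)

theorem IsPrimitiveCircuit.sum_posExponent_smul (h : IsPrimitiveCircuit A κ) :
    ∑ ω : A, posExponent κ ω • ω.1 = ∑ ω : A, posExponent (-κ) ω • ω.1 := by
  rw [← sub_eq_zero, ← Finset.sum_sub_distrib, ← h.relation]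
  refine Finset.sum_congr rfl fun ω _ => ?_
  rw [← natCast_zsmul, ← natCast_zsmul, ← sub_smul]
  congr 1
  simp

theorem IsPrimitiveCircuit.sum_posExponent (h : IsPrimitiveCircuit A κ) :
    ∑ ω : A, posExponent κ ω = ∑ ω : A, posExponent (-κ) ω := by
  zify
  rw [← sub_eq_zero, ← Finset.sum_sub_distrib, ← h.sum_eq_zero]
  refine Finset.sum_congr rfl fun ω _ => ?_
  simp

/-- The homomorphism `x_ω ↦ κ_ω t ^ ω` to the ring of Laurent polynomials. -/
def toricHom (K : Type*) [CommRing K] [Algebra K ℂ] (κ : A → ℤ) :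
    MvPolynomial A K →ₐ[K] AddMonoidAlgebra ℂ (σ → ℤ) :=
  aeval fun ω => AddMonoidAlgebra.single ω.1 (κ ω : ℂ)

variable {K : Type*} [CommRing K] [Algebra K ℂ]

theorem toricHom_monomial (κ : A → ℤ) (m : A →₀ ℕ) (c : K) :
    toricHom K κ (monomial m c) =
      AddMonoidAlgebra.single (∑ ω : A, m ω • ω.1) (algebraMap K ℂ c * ∏ ω, (κ ω : ℂ) ^ m ω) := by
  have h1 : ∏ ω : A, AddMonoidAlgebra.single ω.1 (κ ω : ℂ) ^ m ω =
      AddMonoidAlgebra.single (∑ ω : A, m ω • ω.1) (∏ ω, (κ ω : ℂ) ^ m ω) := by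
    simp [AddMonoidAlgebra.single_pow]
  rw [toricHom, aeval_monomial, Finsupp.prod_fintype _ _ (by simp), h1,
    AddMonoidAlgebra.coe_algebraMap, Function.comp_apply, AddMonoidAlgebra.single_mul_single,
    zero_add]

/-- Both monomials map to multiples of one Laurent monomial; `hab`, the vanishing of the binomial at
the point `κ`, equates the two factors. -/
theorem IsPrimitiveCircuit.toricHom_circuitBinomial (h : IsPrimitiveCircuit A κ) {a b : ℤ}
    (hab : a * ∏ ω, κ ω ^ posExponent κ ω = b * ∏ ω, κ ω ^ posExponent (-κ) ω) :
    toricHom K κ (circuitBinomial K κ a b) = 0 := by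
  rw [circuitBinomial, map_sub, toricHom_monomial, toricHom_monomial, h.sum_posExponent_smul,
    sub_eq_zero]
  congr 1
  simpa using congrArg (Int.cast : ℤ → ℂ) hab

/-- Modulo the binomial, a nonzero multiple of every polynomial is congruent to a polynomial with
no monomial divisible by `x ^ κ⁺`. -/
theorem IsPrimitiveCircuit.exists_reduction {K : Type*} [CommRing K]
    (h : IsPrimitiveCircuit A κ) {a b : ℤ} (ha : a ≠ 0)
    (Q : MvPolynomial A K) :
    ∃ k : ℤ, k ≠ 0 ∧ ∃ R : MvPolynomial A K, (∀ m, posExponent κ ≤ m → coeff m R = 0) ∧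
      circuitBinomial K κ a b ∣ C (k : K) * Q - R := by
  obtain ⟨ω₀, hω₀⟩ := h.exists_pos
  induction Q using MvPolynomial.induction_on' with
  | add Q₁ Q₂ h₁ h₂ =>
    obtain ⟨k₁, hk₁, R₁, hR₁, h₁⟩ := h₁
    obtain ⟨k₂, hk₂, R₂, hR₂, h₂⟩ := h₂
    refine ⟨k₁ * k₂, mul_ne_zero hk₁ hk₂, C (k₂ : K) * R₁ + C (k₁ : K) * R₂, fun m hm => ?_, ?_⟩
    · rw [coeff_add, coeff_C_mul, coeff_C_mul, hR₁ m hm, hR₂ m hm, mul_zero, mul_zero, add_zero]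
    · convert dvd_add (h₁.mul_left (C (k₂ : K))) (h₂.mul_left (C (k₁ : K))) using 1
      push_cast
      rw [C_mul]
      ring
  | monomial m c =>
    -- Trading `x ^ κ⁺` for `x ^ κ⁻` lowers the exponent at `ω₀`, which does not occur in `κ⁻`. Each
    -- trade costs a factor `a`, collected in `k`.
    induction hN : m ω₀ using Nat.strong_induction_on generalizing m c with
    | _ N ih =>
      by_cases hm : posExponent κ ≤ m
      · obtain ⟨k, hk, R, hR, hdvd⟩ := ih ((m - posExponent κ + posExponent (-κ)) ω₀)
          (by have := hm ω₀; simp at this ⊢; omega) _ (b * c) rfl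
        refine ⟨k * a, mul_ne_zero hk ha, R, hR, ?_⟩
        have h1 : C ((k * a : ℤ) : K) * monomial m c - R =
            circuitBinomial K κ a b * (C (k : K) * monomial (m - posExponent κ) c) +
              (C (k : K) * monomial (m - posExponent κ + posExponent (-κ)) ((b : K) * c) - R) := by
          rw [circuitBinomial, sub_mul, mul_left_comm, mul_left_comm (monomial _ _),
            monomial_mul, monomial_mul, add_tsub_cancel_of_le hm, add_comm (posExponent (-κ))]
          simp only [C_mul_monomial]
          push_cast
          rw [mul_assoc]
          ring
        rw [h1]
        exact dvd_add (dvd_mul_right _ _) hdvd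
      · refine ⟨1, one_ne_zero, monomial m c, fun m' hm' => ?_, by simp⟩
        classical
        rw [coeff_monomial, if_neg]
        rintro rfl
        exact hm hm'

/-- The difference `m - m'` is `c κ`; `c > 0` would force `κ⁺ ≤ m`, and `c < 0` would force `κ⁺ ≤
m'`. -/
theorem IsPrimitiveCircuit.injOn_exponents (h : IsPrimitiveCircuit A κ) {m m' : A →₀ ℕ}
    (hm : ¬ posExponent κ ≤ m) (hm' : ¬ posExponent κ ≤ m')
    (hmm' : ∑ ω : A, m ω • ω.1 = ∑ ω : A, m' ω • ω.1) : m = m' := by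
  obtain ⟨c, hc⟩ := h.unique (fun ω => (m ω : ℤ) - m' ω) (by
    simp only [sub_smul, Finset.sum_sub_distrib, natCast_zsmul, hmm', sub_self])
  rcases lt_trichotomy c 0 with hc0 | rfl | hc0
  · refine absurd (fun ω => ?_) hm'
    have h1 := hc ω
    simp only [posExponent_apply]
    by_cases hω : 0 ≤ κ ω
    · have : c * κ ω ≤ -1 * κ ω := mul_le_mul_of_nonneg_right (by omega) hω
      omega
    · omega
  · ext ω
    have := hc ω
    simp at this
    omega
  · refine absurd (fun ω => ?_) hm
    have h1 := hc ω
    simp only [posExponent_apply]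
    by_cases hω : 0 ≤ κ ω
    · have : 1 * κ ω ≤ c * κ ω := mul_le_mul_of_nonneg_right (by omega) hω
      omega
    · omega

/-- The monomials of a reduced polynomial have distinct images, so nothing cancels, and the scaling
factors are nonzero because `κ` vanishes nowhere. -/
theorem IsPrimitiveCircuit.eq_zero_of_toricHom_eq_zero (h : IsPrimitiveCircuit A κ)
    (hK : Function.Injective (algebraMap K ℂ)) {R : MvPolynomial A K}
    (hR : ∀ m, posExponent κ ≤ m → coeff m R = 0) (h0 : toricHom K κ R = 0) : R = 0 := by
  by_contra hne
  obtain ⟨m₀, hm₀⟩ := MvPolynomial.support_nonempty.2 hne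
  have hnorm : ∀ m ∈ R.support, ¬ posExponent κ ≤ m := fun m hm hle =>
    mem_support_iff.1 hm (hR m hle)
  have h1 : (toricHom K κ R).coeff (∑ ω : A, m₀ ω • ω.1) =
      algebraMap K ℂ (coeff m₀ R) * ∏ ω, (κ ω : ℂ) ^ m₀ ω := by
    conv_lhs => rw [R.as_sum]
    rw [map_sum (toricHom K κ), AddMonoidAlgebra.coeff_sum, Finsupp.finsetSum_apply,
      Finset.sum_eq_single m₀]
    · rw [toricHom_monomial]
      simp
    · intro m hm hne'
      rw [toricHom_monomial]
      simp only [AddMonoidAlgebra.coeff_single]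
      exact Finsupp.single_eq_of_ne fun he =>
        hne' (h.injOn_exponents (hnorm m₀ hm₀) (hnorm m hm) he).symm
    · exact fun h' => absurd hm₀ h'
  rw [h0] at h1
  have h2 : ∏ ω, (κ ω : ℂ) ^ m₀ ω ≠ 0 :=
    Finset.prod_ne_zero_iff.2 fun ω _ => pow_ne_zero _ (Int.cast_ne_zero.2 (h.ne_zero ω))
  have h3 : algebraMap K ℂ (coeff m₀ R) ≠ 0 := by
    rw [Ne, map_eq_zero_iff _ hK]
    exact mem_support_iff.1 hm₀
  exact mul_ne_zero h3 h2 (by simpa using h1.symm)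

theorem IsPrimitiveCircuit.exists_dvd_C_mul (h : IsPrimitiveCircuit A κ)
    (hK : Function.Injective (algebraMap K ℂ)) {a b : ℤ} (ha : a ≠ 0)
    (hab : a * ∏ ω, κ ω ^ posExponent κ ω = b * ∏ ω, κ ω ^ posExponent (-κ) ω)
    {Q : MvPolynomial A K} (hQ : toricHom K κ Q = 0) :
    ∃ k : ℤ, k ≠ 0 ∧ circuitBinomial K κ a b ∣ C (k : K) * Q := by
  obtain ⟨k, hk, R, hR, H, hH⟩ := h.exists_reduction (b := b) ha Q
  have h0 : R = 0 := h.eq_zero_of_toricHom_eq_zero hK hR (by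
    have := congrArg (toricHom K κ) hH
    simpa [hQ, h.toricHom_circuitBinomial hab] using this)
  exact ⟨k, hk, H, by simpa [h0] using hH⟩

/-! ### Values on the torus -/

theorem laurentMonomial_ne_zero [Fintype σ] (t : σ → ℂˣ) (m : σ → ℤ) : laurentMonomial t m ≠ 0 :=
  Finset.prod_ne_zero_iff.2 fun _ _ => zpow_ne_zero _ (Units.ne_zero _)

theorem laurentMonomial_add [Fintype σ] (t : σ → ℂˣ) (m m' : σ → ℤ) :
    laurentMonomial t (m + m') = laurentMonomial t m * laurentMonomial t m' := by
  simp [laurentMonomial, zpow_add₀, Finset.prod_mul_distrib]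

theorem laurentMonomial_nsmul [Fintype σ] (t : σ → ℂˣ) (n : ℕ) (m : σ → ℤ) :
    laurentMonomial t (n • m) = laurentMonomial t m ^ n := by
  simp [laurentMonomial, ← Finset.prod_pow, mul_comm (n : ℤ), zpow_mul]

theorem laurentMonomial_sum [Fintype σ] (t : σ → ℂˣ) {ι : Type*} (s : Finset ι) (m : ι → σ → ℤ) :
    laurentMonomial t (∑ i ∈ s, m i) = ∏ i ∈ s, laurentMonomial t (m i) := by
  classical
  induction s using Finset.induction_on with
  | empty => simp [laurentMonomial]
  | insert i s hi ih => rw [Finset.sum_insert hi, Finset.prod_insert hi, laurentMonomial_add, ih]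

theorem laurentMonomial_mul [Fintype σ] (t t' : σ → ℂˣ) (m : σ → ℤ) :
    laurentMonomial (t * t') m = laurentMonomial t m * laurentMonomial t' m := by
  simp [laurentMonomial, mul_zpow, Finset.prod_mul_distrib]

/-- The Laurent monomial of exponent `m` as a character of the torus. -/
def torusCharacter [Fintype σ] (m : σ → ℤ) : (σ → ℂˣ) →* ℂ where
  toFun t := laurentMonomial t m
  map_one' := by simp [laurentMonomial]
  map_mul' t t' := laurentMonomial_mul t t' m

theorem torusCharacter_injective [Fintype σ] :
    Function.Injective (torusCharacter : (σ → ℤ) → (σ → ℂˣ) →* ℂ) := by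
  classical
  intro m m' hmm'
  ext i
  -- The point with coordinate `2` at `i` and `1` elsewhere reads off the exponent at `i`.
  have key : ∀ n : σ → ℤ,
      torusCharacter n (Pi.mulSingle i (Units.mk0 (2 : ℂ) two_ne_zero)) = 2 ^ n i := by
    intro n
    simp only [torusCharacter, MonoidHom.coe_mk, OneHom.coe_mk, laurentMonomial]
    rw [Finset.prod_eq_single i (by intro j _ hj; simp [Pi.mulSingle_eq_of_ne hj]) (by simp)]
    simp
  have h1 := key m
  rw [hmm', key m'] at h1
  have h2 : ((2 : ℝ) ^ m' i) = 2 ^ m i := by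
    simpa using congrArg (‖·‖) h1
  exact (zpow_right_injective₀ (by norm_num) (by norm_num) h2).symm

theorem aeval_toric_eq_linearCombination [Fintype σ] (κ : A → ℤ) (t : σ → ℂˣ)
    (Q : MvPolynomial A K) :
    aeval (fun ω : A => (κ ω : ℂ) * laurentMonomial t ω.1) Q =
      Finsupp.linearCombination ℂ (fun m => laurentMonomial t m) (toricHom K κ Q).coeff := by
  induction Q using MvPolynomial.induction_on' with
  | add Q₁ Q₂ h₁ h₂ => rw [map_add, map_add, AddMonoidAlgebra.coeff_add, map_add, h₁, h₂]
  | monomial m c =>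
    rw [toricHom_monomial, AddMonoidAlgebra.coeff_single, Finsupp.linearCombination_single,
      aeval_monomial, Finsupp.prod_fintype _ _ (by simp), laurentMonomial_sum]
    simp only [mul_pow, Finset.prod_mul_distrib, laurentMonomial_nsmul, smul_eq_mul]
    ring

/-- Distinct Laurent monomials are distinct characters of the torus, hence linearly independent by
Dedekind. -/
theorem toricHom_eq_zero_of_aeval [Fintype σ] (κ : A → ℤ) (Q : MvPolynomial A K)
    (hQ : ∀ t : σ → ℂˣ, aeval (fun ω : A => (κ ω : ℂ) * laurentMonomial t ω.1) Q = 0) :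
    toricHom K κ Q = 0 := by
  have hli := (linearIndependent_monoidHom (σ → ℂˣ) ℂ).comp _ (torusCharacter_injective (σ := σ))
  rw [linearIndependent_iff] at hli
  refine AddMonoidAlgebra.coeff_injective (hli _ ?_)
  ext t
  rw [Pi.zero_apply, ← hQ t, aeval_toric_eq_linearCombination]
  simp only [Finsupp.linearCombination_apply, Finsupp.sum, Finset.sum_apply]
  rfl

end Circuit

/-! ### The discriminant of a circuit. -/

section CircuitDiscriminant

variable {σ : Type*} {A : Finset (σ → ℤ)} {κ : A → ℤ}

theorem posExponent_ne_posExponent_neg (h : IsPrimitiveCircuit A κ) :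
    posExponent κ ≠ posExponent (-κ) := by
  obtain ⟨ω, hω⟩ := h.exists_pos
  intro he
  have := DFunLike.congr_fun he ω
  simp at this
  omega

theorem aeval_circuitBinomial {K L : Type*} [CommRing K] [CommRing L] [Algebra K L] (a b : ℤ)
    (c : A → L) : aeval c (circuitBinomial K κ a b) =
      a * ∏ ω, c ω ^ posExponent κ ω - b * ∏ ω, c ω ^ posExponent (-κ) ω := by
  rw [circuitBinomial, map_sub, aeval_monomial, aeval_monomial,
    Finsupp.prod_fintype _ _ (by simp), Finsupp.prod_fintype _ _ (by simp), map_intCast,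
    map_intCast]

/-- Only multiples of the relation `κ` are complex linear relations between the points of `A`. -/
theorem IsPrimitiveCircuit.eq_smul_of_relation [Fintype σ] (h : IsPrimitiveCircuit A κ)
    (z : A → ℂ) (hz : ∀ i, ∑ ω : A, z ω * (ω.1 i : ℂ) = 0) :
    ∃ l : ℂ, ∀ ω, z ω = l * κ ω := by
  classical
  obtain ⟨ω₀⟩ := h.nonempty
  have h0 : (κ ω₀ : ℂ) ≠ 0 := Int.cast_ne_zero.2 (h.ne_zero ω₀)
  refine ⟨z ω₀ / κ ω₀, fun ω => ?_⟩
  -- The function `κ_{ω₀} δ_ω - κ_ω δ_{ω₀}` is orthogonal to `κ`, hence linear on `A`, hence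
  -- orthogonal to `z`. This is the proportionality of `z` and `κ` at `ω` and `ω₀`.
  obtain ⟨s, hs⟩ := h.exists_extension
    (fun ω' => (if ω' = ω then (κ ω₀ : ℂ) else 0) - if ω' = ω₀ then (κ ω : ℂ) else 0) (by
      simp [mul_sub, Finset.sum_sub_distrib, mul_comm])
  have h1 : ∑ ω', z ω' *
      ((if ω' = ω then (κ ω₀ : ℂ) else 0) - if ω' = ω₀ then (κ ω : ℂ) else 0) = 0 := by
    simp only [hs, zsmul_eq_mul, Finset.mul_sum]
    rw [Finset.sum_comm]
    refine Finset.sum_eq_zero fun i _ => ?_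
    simp only [← mul_assoc, ← Finset.sum_mul, hz, zero_mul]
  simp only [mul_sub, Finset.sum_sub_distrib, mul_ite, mul_zero, Finset.sum_ite_eq',
    Finset.mem_univ, if_true] at h1
  field_simp
  linear_combination h1

theorem coeff_circuitBinomial (h : IsPrimitiveCircuit A κ) (a b : ℤ) :
    coeff (posExponent κ) (circuitBinomial ℤ κ a b) = a ∧
      coeff (posExponent (-κ)) (circuitBinomial ℤ κ a b) = -b := by
  classical
  have := posExponent_ne_posExponent_neg h
  constructor <;> simp [circuitBinomial, coeff_monomial, this, this.symm]

/-- Coprimality of `a` and `b` removes the integer factor, as in Gauss's lemma: a common divisor of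
the binomial and `k` is a constant dividing both `a` and `b`. -/
theorem IsPrimitiveCircuit.circuitBinomial_dvd (h : IsPrimitiveCircuit A κ) {a b : ℤ}
    (ha : a ≠ 0) (hcop : IsCoprime a b)
    (hab : a * ∏ ω, κ ω ^ posExponent κ ω = b * ∏ ω, κ ω ^ posExponent (-κ) ω)
    {Q : MvPolynomial A ℤ} (hQ : toricHom ℤ κ Q = 0) : circuitBinomial ℤ κ a b ∣ Q := by
  obtain ⟨k, hk, hdvd⟩ := h.exists_dvd_C_mul
    (RingHom.injective_int (algebraMap ℤ ℂ)) ha hab hQ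
  refine IsRelPrime.dvd_of_dvd_mul_left ?_ hdvd
  intro e he hek
  obtain ⟨e', -, rfl⟩ := (dvd_C_iff_exists (by simpa using hk)).1 hek
  rw [C_dvd_iff_dvd_coeff] at he
  have h1 := he (posExponent κ)
  have h2 := he (posExponent (-κ))
  rw [(coeff_circuitBinomial h a b).1] at h1
  rw [(coeff_circuitBinomial h a b).2, dvd_neg] at h2
  exact (hcop.isUnit_of_dvd' h1 h2).map C

/-- The binomial generates the kernel of a homomorphism to a domain, the Laurent polynomials. -/
theorem IsPrimitiveCircuit.prime_circuitBinomial (h : IsPrimitiveCircuit A κ) {a b : ℤ}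
    (ha : a ≠ 0) (hcop : IsCoprime a b)
    (hab : a * ∏ ω, κ ω ^ posExponent κ ω = b * ∏ ω, κ ω ^ posExponent (-κ) ω) :
    Prime (circuitBinomial ℤ κ a b) := by
  have h0 := h.toricHom_circuitBinomial (K := ℤ) hab
  refine ⟨fun hz => ha ?_, fun hu => ?_, fun Q Q' hdvd => ?_⟩
  · rw [← (coeff_circuitBinomial h a b).1, hz, coeff_zero]
  · exact not_isUnit_zero (h0 ▸ hu.map (toricHom ℤ κ))
  · obtain ⟨H, hH⟩ := hdvd
    have := congrArg (toricHom ℤ κ) hH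
    rw [map_mul, map_mul, h0, zero_mul] at this
    exact (mul_eq_zero.1 this).imp (h.circuitBinomial_dvd ha hcop hab)
      (h.circuitBinomial_dvd ha hcop hab)

variable [Fintype σ] [DecidableEq σ]

/-- The singular point is `t⁻¹`: there the monomials cancel, and the equations become `∑ κ_ω = 0`
and `∑ κ_ω ω = 0`. -/
theorem IsPrimitiveCircuit.toric_mem_singularLocus (h : IsPrimitiveCircuit A κ) (t : σ → ℂˣ) :
    (fun ω : A => (κ ω : ℂ) * laurentMonomial t ω.1) ∈ singularLocus A := by
  have hinv : ∀ m m' : σ → ℤ, laurentMonomial t m * laurentMonomial t⁻¹ (m - m') =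
      laurentMonomial t m' := by
    intro m m'
    simp only [laurentMonomial, ← Finset.prod_mul_distrib]
    refine Finset.prod_congr rfl fun i _ => ?_
    rw [Pi.inv_apply, Units.val_inv_eq_inv_val, inv_zpow', ← zpow_add₀ (Units.ne_zero _)]
    simp
  refine ⟨t⁻¹, ?_, fun i => ?_⟩
  · have h1 : ∀ ω : A, (κ ω : ℂ) * laurentMonomial t ω.1 * laurentMonomial t⁻¹ ω.1 = κ ω := by
      intro ω
      have := hinv ω.1 0
      rw [sub_zero] at this
      rw [mul_assoc, this]
      simp [laurentMonomial]
    simp only [laurentValue, h1]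
    exact_mod_cast h.sum_eq_zero
  · have h1 : ∀ ω : A, (κ ω : ℂ) * laurentMonomial t ω.1 * (ω.1 i : ℂ) *
        laurentMonomial t⁻¹ (ω.1 - Pi.single i 1) =
        (κ ω * ω.1 i : ℤ) * laurentMonomial t (Pi.single i 1) := by
      intro ω
      rw [← hinv ω.1 (Pi.single i 1)]
      push_cast
      ring
    simp only [laurentPartial, h1, ← Finset.sum_mul, ← Int.cast_sum]
    have := congrFun h.relation i
    simp only [Finset.sum_apply, Pi.smul_apply, smul_eq_mul, Pi.zero_apply] at this
    rw [this]
    simp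

/-- The partial derivatives make `c_ω t ^ ω = l κ_ω`. The monomials `x ^ κ⁺` and `x ^ κ⁻` scale
alike under `t` and `l`, so the claim reduces to `hab`. -/
theorem IsPrimitiveCircuit.aeval_eq_zero_of_mem_singularLocus {K : Type*} [CommRing K]
    [Algebra K ℂ] (h : IsPrimitiveCircuit A κ) {a b : ℤ}
    (hab : a * ∏ ω, κ ω ^ posExponent κ ω = b * ∏ ω, κ ω ^ posExponent (-κ) ω) {c : A → ℂ}
    (hc : c ∈ singularLocus A) : aeval c (circuitBinomial K κ a b) = 0 := by
  obtain ⟨t, -, ht⟩ := hc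
  obtain ⟨l, hl⟩ := h.eq_smul_of_relation (fun ω => c ω * laurentMonomial t ω.1) (fun i => by
    rw [← zero_mul (laurentMonomial t (Pi.single i 1)), ← ht i, laurentPartial, Finset.sum_mul]
    refine Finset.sum_congr rfl fun ω _ => ?_
    conv_lhs => rw [← sub_add_cancel ω.1 (Pi.single i 1), laurentMonomial_add, sub_add_cancel]
    ring)
  have key : ∀ m : A →₀ ℕ, (∏ ω, c ω ^ m ω) * laurentMonomial t (∑ ω : A, m ω • ω.1) =
      l ^ (∑ ω, m ω) * ((∏ ω, κ ω ^ m ω : ℤ) : ℂ) := by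
    intro m
    rw [laurentMonomial_sum, ← Finset.prod_mul_distrib]
    simp only [laurentMonomial_nsmul, ← mul_pow, hl]
    push_cast
    simp only [mul_pow, Finset.prod_mul_distrib, Finset.prod_pow_eq_pow_sum]
  have h1 := key (posExponent κ)
  have h2 := key (posExponent (-κ))
  rw [← h.sum_posExponent_smul, ← h.sum_posExponent] at h2
  have h3 : (a : ℂ) * ((∏ ω, κ ω ^ posExponent κ ω : ℤ) : ℂ) =
      b * ((∏ ω, κ ω ^ posExponent (-κ) ω : ℤ) : ℂ) := by exact_mod_cast hab
  rw [aeval_circuitBinomial]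
  refine (mul_eq_zero.1 ?_).resolve_right
    (laurentMonomial_ne_zero t (∑ ω : A, posExponent κ ω • ω.1))
  linear_combination (a : ℂ) * h1 - (b : ℂ) * h2 + l ^ (∑ ω, posExponent κ ω) * h3

theorem IsPrimitiveCircuit.discriminantVariety_eq (h : IsPrimitiveCircuit A κ) {a b : ℤ}
    (ha : a ≠ 0)
    (hab : a * ∏ ω, κ ω ^ posExponent κ ω = b * ∏ ω, κ ω ^ posExponent (-κ) ω) :
    {c : A → ℂ | aeval c (circuitBinomial ℤ κ a b) = 0} = discriminantVariety A := by
  -- The vanishing ideal has complex coefficients, so the division must take place over `ℂ`.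
  have haeval : ∀ c : A → ℂ, aeval c (circuitBinomial ℤ κ a b) =
      aeval c (circuitBinomial ℂ κ a b) := fun c => by simp only [aeval_circuitBinomial]
  ext c
  rw [Set.mem_ofPred_eq, haeval, discriminantVariety, mem_zeroLocus_iff]
  constructor
  · intro hc Q hQ
    obtain ⟨k, hk, hdvd⟩ := h.exists_dvd_C_mul Function.injective_id ha hab
      (toricHom_eq_zero_of_aeval κ Q fun t => hQ _ (h.toric_mem_singularLocus t))
    obtain ⟨H, hH⟩ := hdvd
    have := congrArg (aeval c) hH
    rw [map_mul, map_mul, hc, zero_mul, aeval_C] at this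
    exact (mul_eq_zero.1 this).resolve_left (by simpa using hk)
  · exact fun hc => hc _ fun x hx => h.aeval_eq_zero_of_mem_singularLocus hab hx

/-- The discriminant of a primitive circuit is a binomial. -/
theorem IsPrimitiveCircuit.aDiscriminant_eq (h : IsPrimitiveCircuit A κ) {a b : ℤ}
    (ha : a ≠ 0) (hcop : IsCoprime a b)
    (hab : a * ∏ ω, κ ω ^ posExponent κ ω = b * ∏ ω, κ ω ^ posExponent (-κ) ω) :
    ∃ ε : ℤˣ, aDiscriminant A = C (ε : ℤ) * circuitBinomial ℤ κ a b := by
  have hex : ∃ D, DefinesDiscriminantVariety A D :=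
    ⟨_, (h.prime_circuitBinomial ha hcop hab).irreducible, h.discriminantVariety_eq ha hab⟩
  rw [aDiscriminant, dif_pos hex]
  obtain ⟨hirr, hvar⟩ := hex.choose_spec
  -- Any defining polynomial vanishes at the toric points, so the binomial divides it;
  -- irreducibility leaves only a unit of `ℤ`.
  have hdvd : circuitBinomial ℤ κ a b ∣ hex.choose := by
    refine h.circuitBinomial_dvd ha hcop hab (toricHom_eq_zero_of_aeval κ _ fun t => ?_)
    have : (fun ω : A => (κ ω : ℂ) * laurentMonomial t ω.1) ∈ discriminantVariety A :=
      fun Q hQ => hQ _ (h.toric_mem_singularLocus t)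
    rwa [← hvar] at this
  obtain ⟨u, hu⟩ := (h.prime_circuitBinomial ha hcop hab).irreducible.associated_of_dvd hirr hdvd
  obtain ⟨e, he, heu⟩ := isUnit_iff_eq_C_of_isReduced.1 u.isUnit
  refine ⟨he.unit, ?_⟩
  rw [← hu, heu, mul_comm]
  rfl

end CircuitDiscriminant

/-! ### The triangulations of a circuit. -/

section CircuitTriangulation

variable {σ : Type*} {A : Finset (σ → ℤ)} {κ : A → ℤ}

/-- The triangulation of a circuit with the simplices `conv (A \ {ω})`, `0 < κ ω`. -/
def positiveTriangulation (κ : A → ℤ) : Set (Set A) :=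
  {S | ∃ ω, 0 < κ ω ∧ S = {ω' | ω' ≠ ω}}

theorem IsPrimitiveCircuit.sum_mul_affineMap (h : IsPrimitiveCircuit A κ)
    (l : (σ → ℝ) →ᵃ[ℝ] ℝ) : ∑ ω : A, (κ ω : ℝ) * l (fun i => (ω.1 i : ℝ)) = 0 := by
  obtain ⟨c, h1⟩ : ∃ c, ∀ x, l x = l.linear x + c :=
    ⟨l 0, fun x => by simpa using congrFun l.decomp x⟩
  have h2 : ∑ ω : A, (κ ω : ℝ) • (fun i => (ω.1 i : ℝ)) = 0 := by
    ext i
    have := congrFun h.relation i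
    simp only [Finset.sum_apply, Pi.smul_apply, smul_eq_mul, Pi.zero_apply] at this ⊢
    exact_mod_cast this
  have h3 : ∑ ω, (κ ω : ℝ) = 0 := by exact_mod_cast h.sum_eq_zero
  simp only [h1, mul_add, Finset.sum_add_distrib, ← Finset.sum_mul, h3, zero_mul, add_zero]
  simp only [← smul_eq_mul, ← map_smul, ← map_sum, h2, map_zero]

variable [Fintype σ]

theorem IsPrimitiveCircuit.exists_linearMap (h : IsPrimitiveCircuit A κ) (x : A → ℝ)
    (hx : ∑ ω, (κ ω : ℝ) * x ω = 0) :
    ∃ l : (σ → ℝ) →ₗ[ℝ] ℝ, ∀ ω : A, l (fun i => (ω.1 i : ℝ)) = x ω := by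
  obtain ⟨s, hs⟩ := h.exists_extension x (by simpa [zsmul_eq_mul] using hx)
  exact ⟨Fintype.linearCombination ℝ s, fun ω => by
    simp [hs, Fintype.linearCombination_apply]⟩

/-- Correcting `x` at `ω₀` alone makes it orthogonal to `κ`. The sign of the correction tells on
which side of the hyperplane the lifted `ω₀` lies. -/
theorem IsPrimitiveCircuit.exists_linearMap_of_ne (h : IsPrimitiveCircuit A κ) (ω₀ : A)
    (x : A → ℝ) :
    ∃ l : (σ → ℝ) →ₗ[ℝ] ℝ, (∀ ω : A, ω ≠ ω₀ → l (fun i => (ω.1 i : ℝ)) = x ω) ∧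
      κ ω₀ * (l (fun i => (ω₀.1 i : ℝ)) - x ω₀) = -∑ ω, (κ ω : ℝ) * x ω := by
  classical
  have h0 : (κ ω₀ : ℝ) ≠ 0 := Int.cast_ne_zero.2 (h.ne_zero ω₀)
  obtain ⟨l, hl⟩ := h.exists_linearMap
    (fun ω => x ω - if ω = ω₀ then (∑ ω, (κ ω : ℝ) * x ω) / κ ω₀ else 0) (by
      simp only [mul_sub, Finset.sum_sub_distrib, mul_ite, mul_zero, Finset.sum_ite_eq',
        Finset.mem_univ, if_true]
      field_simp
      simp)
  refine ⟨l, fun ω hω => by simp [hl, hω], ?_⟩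
  rw [hl, if_pos rfl]
  field_simp
  ring

theorem IsPrimitiveCircuit.affineIndependent (h : IsPrimitiveCircuit A κ) (ω₀ : A) :
    AffineIndependent ℝ
      (fun ω : {ω : A | ω ≠ ω₀} => fun i => (ω.1.1 i : ℝ)) := by
  classical
  refine LinearIndependent.affineIndependent (k := ℝ) (V := σ → ℝ) ?_
  rw [Fintype.linearIndependent_iff]
  intro g hg ω
  -- A dual functional: `1` at `ω` and `0` at the other points of the simplex.
  obtain ⟨l, hl, -⟩ := h.exists_linearMap_of_ne ω₀ (Pi.single ω.1 1)
  have := congrArg l hg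
  simp only [map_sum, map_smul, map_zero, smul_eq_mul] at this
  rw [Finset.sum_congr rfl fun ω' _ => by rw [hl ω'.1 ω'.2], Finset.sum_eq_single ω] at this
  · simpa using this
  · intro b _ hb
    rw [Pi.single_eq_of_ne fun he => hb (Subtype.ext he), mul_zero]
  · simp

theorem IsPrimitiveCircuit.inducesTriangulation (h : IsPrimitiveCircuit A κ) {ψ : A → ℝ}
    (hψ : ∑ ω, (κ ω : ℝ) * ψ ω < 0) : InducesTriangulation A ψ (positiveTriangulation κ) := by
  -- If a cell contained all `ω` with `κ ω > 0`, every term of `∑ κ (l - ψ)` would be nonpositive,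
  -- while the sum is `-∑ κ ψ > 0`.
  have hmiss : ∀ S, IsCell A ψ S → ∃ ω, 0 < κ ω ∧ ω ∉ S := by
    rintro S ⟨l, hle, rfl⟩
    by_contra! hS
    have h1 : ∑ ω, (κ ω : ℝ) * (l (fun i => (ω.1 i : ℝ)) - ψ ω) ≤ 0 :=
      Finset.sum_nonpos fun ω _ => by
        rcases le_or_gt (κ ω) 0 with hω | hω
        · exact mul_nonpos_of_nonpos_of_nonneg (by exact_mod_cast hω) (sub_nonneg.2 (hle ω))
        · have : l (fun i => (ω.1 i : ℝ)) = ψ ω := hS ω hω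
          rw [this, sub_self, mul_zero]
    simp only [mul_sub, Finset.sum_sub_distrib, h.sum_mul_affineMap] at h1
    linarith
  have hcell : ∀ ω, 0 < κ ω → IsCell A ψ {ω' | ω' ≠ ω} := by
    intro ω hω
    obtain ⟨l, hl, hlω⟩ := h.exists_linearMap_of_ne ω ψ
    have hω' : (0 : ℝ) < κ ω := by exact_mod_cast hω
    have hgt : 0 < l (fun i => (ω.1 i : ℝ)) - ψ ω :=
      pos_of_mul_pos_right (by rw [hlω]; linarith) hω'.le
    refine ⟨l.toAffineMap, fun ω' => ?_, ?_⟩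
    · by_cases he : ω' = ω
      · subst he
        exact (sub_pos.1 hgt).le
      · exact (hl ω' he).ge
    · ext ω'
      refine ⟨fun he => hl ω' he, fun he heq => ?_⟩
      subst heq
      exact (sub_pos.1 hgt).ne' he
  refine ⟨?_, ?_⟩
  · ext S
    constructor
    · rintro ⟨hS, hmax⟩
      obtain ⟨ω, hω, hωS⟩ := hmiss S hS
      have hle : S ≤ {ω' | ω' ≠ ω} := fun ω' hω' he => hωS (he ▸ hω')
      exact ⟨ω, hω, le_antisymm hle (hmax (hcell ω hω) hle)⟩
    · rintro ⟨ω, hω, rfl⟩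
      refine ⟨hcell ω hω, fun S hS hle => ?_⟩
      obtain ⟨ω', -, hω'S⟩ := hmiss S hS
      have : ω' = ω := by
        by_contra hne
        exact hω'S (hle hne)
      subst this
      exact fun ω'' hω'' he => hω'S (he ▸ hω'')
  · rintro S ⟨ω, -, rfl⟩
    exact h.affineIndependent ω

/-- Conversely, for the affine function of the cell omitting `ω`, only `ω` contributes to `∑ κ (l -
ψ) = -∑ κ ψ`, and it does so positively. -/
theorem IsPrimitiveCircuit.inducesTriangulation_iff (h : IsPrimitiveCircuit A κ) {ψ : A → ℝ} :
    InducesTriangulation A ψ (positiveTriangulation κ) ↔ ∑ ω, (κ ω : ℝ) * ψ ω < 0 := by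
  refine ⟨fun hind => ?_, h.inducesTriangulation⟩
  obtain ⟨ω, hω⟩ := h.exists_pos
  have hmem : {ω' | ω' ≠ ω} ∈ positiveTriangulation κ := ⟨ω, hω, rfl⟩
  rw [← hind.1] at hmem
  obtain ⟨l, hle, heq⟩ := hmem.1
  have hne : ∀ ω', l (fun i => (ω'.1 i : ℝ)) = ψ ω' ↔ ω' ≠ ω := fun ω' =>
    (Set.ext_iff.1 heq ω').symm
  have hlt : ψ ω < l (fun i => (ω.1 i : ℝ)) :=
    lt_of_le_of_ne (hle ω) fun he => (hne ω).1 he.symm rfl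
  have h1 := h.sum_mul_affineMap l
  have h2 : ∑ ω', (κ ω' : ℝ) * (l (fun i => (ω'.1 i : ℝ)) - ψ ω') =
      κ ω * (l (fun i => (ω.1 i : ℝ)) - ψ ω) :=
    Finset.sum_eq_single ω (fun ω' _ he => by rw [(hne ω').2 he, sub_self, mul_zero]) (by simp)
  simp only [mul_sub, Finset.sum_sub_distrib, h1] at h2
  have h3 : (0 : ℝ) < κ ω := by exact_mod_cast hω
  nlinarith [mul_pos h3 (sub_pos.2 hlt)]

/-- In a polynomial with the two exponents `κ⁺` and `κ⁻`, the exponent `κ⁻` corresponds to the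
triangulation with the simplices `conv (A \ {ω})`, `0 < κ ω`. -/
theorem IsPrimitiveCircuit.correspondsToTriangulation (h : IsPrimitiveCircuit A κ)
    {D : MvPolynomial A ℤ} (hD : ∀ m, m ∈ D.support ↔ m = posExponent κ ∨ m = posExponent (-κ)) :
    CorrespondsToTriangulation A D (posExponent (-κ)) (positiveTriangulation κ) := by
  refine ⟨(hD _).2 (Or.inr rfl), ⟨fun ω => -κ ω, ?_⟩, fun ψ hψ m hm hne => ?_⟩
  · rw [h.inducesTriangulation_iff]
    simp only [mul_neg, Finset.sum_neg_distrib, Left.neg_neg_iff]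
    obtain ⟨ω⟩ := h.nonempty
    exact Finset.sum_pos (fun ω _ => mul_self_pos.2 (Int.cast_ne_zero.2 (h.ne_zero ω))) ⟨ω, by simp⟩
  · rw [h.inducesTriangulation_iff] at hψ
    obtain rfl : m = posExponent κ := ((hD m).1 hm).resolve_right hne
    rw [← sub_neg, ← Finset.sum_sub_distrib]
    refine lt_of_eq_of_lt (Finset.sum_congr rfl fun ω _ => ?_) hψ
    rw [← mul_sub, mul_comm]
    congr 1
    simp only [posExponent_apply, Pi.neg_apply]
    have : ((κ ω).toNat : ℤ) - (-κ ω).toNat = κ ω := by omega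
    exact_mod_cast this

end CircuitTriangulation

/-! ### The Cayley configuration as a circuit. -/

section WeightedProjectiveSpace

variable {d r : ℕ} {w : Fin (d + 1) → ℕ} {v : Fin (d + 1) → Fin d → ℤ} {p : Fin (d + 1) → Fin r}

/-- The relations between the rays of a weighted projective space are the multiples of the vector
of weights. -/
theorem exists_eq_mul_weights (hw : ∀ k, 0 < w k) (hgcd : Finset.univ.gcd w = 1)
    (hgen : Submodule.span ℤ (Set.range v) = ⊤) (hrel : ∑ k, (w k : ℤ) • v k = 0)
    (z : Fin (d + 1) → ℤ) (hz : ∑ k, z k • v k = 0) : ∃ c : ℤ, ∀ k, z k = c * w k := by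
  set L := Fintype.linearCombination ℤ v with hL
  have hrange : Module.finrank ℤ (LinearMap.range L) = d := by
    rw [hL, Fintype.range_linearCombination, hgen, finrank_top, Module.finrank_fin_fun]
  -- The relation module has rank `(d + 1) - d = 1`, so `z` and `w` are linearly dependent.
  have hker : Module.finrank ℤ (LinearMap.ker L) = 1 := by
    have := (LinearMap.ker L).finrank_quotient_add_finrank
    rw [L.quotKerEquivRange.finrank_eq, hrange, Module.finrank_fin_fun] at this
    omega
  let z' : LinearMap.ker L := ⟨z, by simpa [hL, Fintype.linearCombination_apply] using hz⟩
  let w' : LinearMap.ker L :=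
    ⟨fun k => w k, by simpa [hL, Fintype.linearCombination_apply] using hrel⟩
  have hdep : ¬ LinearIndependent ℤ ![z', w'] := fun hli => by
    have := hli.fintype_card_le_finrank
    simp [hker] at this
  rw [LinearIndependent.pair_iff] at hdep
  push Not at hdep
  obtain ⟨s, t, hst, hne⟩ := hdep
  have hst' : ∀ k, s * z k + t * w k = 0 := fun k => congrFun (congrArg Subtype.val hst) k
  have hs : s ≠ 0 := by
    rintro rfl
    have := hst' 0
    have h0 := hw 0
    simp only [zero_mul, zero_add, mul_eq_zero] at this
    exact hne rfl (this.resolve_right (by omega))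
  -- From `s z + t w = 0`, `s` divides every `t w_k`, hence `t` times the gcd of the weights, which
  -- is `1`.
  have hdvd : s ∣ t := by
    have h1 : s.natAbs ∣ t.natAbs * Finset.univ.gcd w := by
      rw [← normalize_eq t.natAbs, ← Finset.gcd_mul_left]
      refine Finset.dvd_gcd fun k _ => ?_
      rw [← Int.natAbs_natCast (w k), ← Int.natAbs_mul, Int.natAbs_dvd_natAbs]
      exact ⟨-z k, by linear_combination hst' k⟩
    rwa [hgcd, mul_one, Int.natAbs_dvd_natAbs] at h1
  obtain ⟨q, rfl⟩ := hdvd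
  exact ⟨-q, fun k => mul_left_cancel₀ hs (by linear_combination hst' k)⟩

/-- The points `e_j` and `u_k` of the Cayley configuration. -/
def cayleyPoint (v : Fin (d + 1) → Fin d → ℤ) (p : Fin (d + 1) → Fin r) :
    Fin r ⊕ Fin (d + 1) → cayleySet v p :=
  Sum.elim (fun j => ⟨cayleyE d j, by simp [cayleySet]⟩)
    fun k => ⟨cayleyU v p k, by simp [cayleySet]⟩

/-- A zero or repeated ray would give a relation `δ_k` or `δ_k - δ_k'`, which is no multiple of the
positive vector `w`. Since `d > 0`, there is a second index to refute the former. -/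
theorem cayleyPoint_bijective (hd : 0 < d) (hw : ∀ k, 0 < w k) (hgcd : Finset.univ.gcd w = 1)
    (hgen : Submodule.span ℤ (Set.range v) = ⊤) (hrel : ∑ k, (w k : ℤ) • v k = 0) :
    Function.Bijective (cayleyPoint v p) := by
  have hker := exists_eq_mul_weights hw hgcd hgen hrel
  have hv0 : ∀ k, v k ≠ 0 := by
    intro k hk
    obtain ⟨c, hc⟩ := hker (Pi.single k 1) (by
      rw [Finset.sum_eq_single k (by intro b _ hb; simp [hb]) (by simp), hk, smul_zero])
    have : Nontrivial (Fin (d + 1)) := Fin.nontrivial_iff_two_le.2 (by omega)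
    obtain ⟨k', hk'⟩ := exists_ne k
    have h1 := hc k'
    have h2 := hw k'
    rw [Pi.single_eq_of_ne hk', eq_comm, mul_eq_zero] at h1
    have h3 := hc k
    rw [h1.resolve_right (by omega), Pi.single_eq_same] at h3
    omega
  have hvinj : Function.Injective v := by
    intro k k' hkk'
    by_contra hne
    obtain ⟨c, hc⟩ := hker (Pi.single k 1 - Pi.single k' 1) (by
      simp only [Pi.sub_apply, sub_smul, Finset.sum_sub_distrib]
      rw [Finset.sum_eq_single k (by intro b _ hb; simp [hb]) (by simp),
        Finset.sum_eq_single k' (by intro b _ hb; simp [hb]) (by simp), hkk']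
      simp)
    have h1 := hc k
    have h2 := hc k'
    have h3 : (0 : ℤ) < w k := by exact_mod_cast hw k
    have h4 : (0 : ℤ) < w k' := by exact_mod_cast hw k'
    simp only [Pi.sub_apply, Pi.single_eq_same, Pi.single_eq_of_ne hne,
      Pi.single_eq_of_ne (Ne.symm hne)] at h1 h2
    nlinarith
  have hl : ∀ (x : Fin r ⊕ Fin (d + 1)) (i : Fin d), (cayleyPoint v p x).1 (Sum.inl i) =
      Sum.elim (fun _ => 0) v x i := by
    rintro (j | k) i <;> rfl
  refine ⟨?_, ?_⟩
  · rintro (j | k) (j' | k') he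
    · have := congrFun (congrArg Subtype.val he) (Sum.inr j)
      by_contra hne
      have hjj' : j ≠ j' := fun h => hne (h ▸ rfl)
      simp [cayleyPoint, cayleyE, hjj'] at this
    · exact absurd (funext fun i => by
        simpa [hl] using congrFun (congrArg Subtype.val he.symm) (Sum.inl i)) (hv0 k')
    · exact absurd (funext fun i => by
        simpa [hl] using congrFun (congrArg Subtype.val he) (Sum.inl i)) (hv0 k)
    · rw [hvinj (funext fun i => by
        simpa [hl] using congrFun (congrArg Subtype.val he) (Sum.inl i) : v k = v k')]
  · rintro ⟨ω, hω⟩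
    simp only [cayleySet, Finset.mem_union, Finset.mem_image, Finset.mem_univ, true_and] at hω
    rcases hω with ⟨j, rfl⟩ | ⟨k, rfl⟩
    · exact ⟨Sum.inl j, rfl⟩
    · exact ⟨Sum.inr k, rfl⟩

theorem sum_cayleySet (hbij : Function.Bijective (cayleyPoint v p)) {M : Type*} [AddCommMonoid M]
    (f : cayleySet v p → M) :
    ∑ ω, f ω = ∑ j, f (cayleyPoint v p (Sum.inl j)) + ∑ k, f (cayleyPoint v p (Sum.inr k)) := by
  rw [← (Equiv.ofBijective _ hbij).sum_comp, Fintype.sum_sum_type]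
  rfl

theorem prod_cayleySet (hbij : Function.Bijective (cayleyPoint v p)) {M : Type*} [CommMonoid M]
    (f : cayleySet v p → M) :
    ∏ ω, f ω = (∏ j, f (cayleyPoint v p (Sum.inl j))) * ∏ k, f (cayleyPoint v p (Sum.inr k)) := by
  rw [← (Equiv.ofBijective _ hbij).prod_comp, Fintype.prod_sum_type]
  rfl

/-- The relation `∑ w_k u_k = ∑ d_j e_j` between the points of the Cayley configuration. -/
def cayleyRelation (w : Fin (d + 1) → ℕ) (hbij : Function.Bijective (cayleyPoint v p)) :
    cayleySet v p → ℤ :=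
  fun ω => Sum.elim (fun j => -(partDegree w p j : ℤ)) (fun k => (w k : ℤ))
    ((Equiv.ofBijective _ hbij).symm ω)

@[simp]
theorem cayleyRelation_inl (w : Fin (d + 1) → ℕ) (hbij : Function.Bijective (cayleyPoint v p))
    (j : Fin r) : cayleyRelation w hbij (cayleyPoint v p (Sum.inl j)) = -(partDegree w p j : ℤ) := by
  rw [cayleyRelation, Equiv.ofBijective_symm_apply_apply, Sum.elim_inl]

@[simp]
theorem cayleyRelation_inr (w : Fin (d + 1) → ℕ) (hbij : Function.Bijective (cayleyPoint v p))
    (k : Fin (d + 1)) : cayleyRelation w hbij (cayleyPoint v p (Sum.inr k)) = w k := by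
  rw [cayleyRelation, Equiv.ofBijective_symm_apply_apply, Sum.elim_inr]

theorem partDegree_pos (hw : ∀ k, 0 < w k) (hp : Function.Surjective p) (j : Fin r) :
    0 < partDegree w p j := by
  obtain ⟨k, rfl⟩ := hp j
  exact Finset.sum_pos (fun k _ => hw k) ⟨k, by simp⟩

theorem sum_partDegree (w : Fin (d + 1) → ℕ) (p : Fin (d + 1) → Fin r) :
    ∑ j, partDegree w p j = ∑ k, w k :=
  Finset.sum_fiberwise _ _ _

theorem sum_smul_cayleySet_apply (hbij : Function.Bijective (cayleyPoint v p))
    (z : cayleySet v p → ℤ) :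
    ∑ ω : cayleySet v p, z ω • ω.1 =
      Sum.elim (∑ k, z (cayleyPoint v p (Sum.inr k)) • v k) fun j =>
        z (cayleyPoint v p (Sum.inl j)) + ∑ k with p k = j, z (cayleyPoint v p (Sum.inr k)) := by
  rw [sum_cayleySet hbij]
  ext (i | j)
  · simp [cayleyPoint, cayleyE, cayleyU, Finset.sum_apply]
  · simp [cayleyPoint, cayleyE, cayleyU, Finset.sum_apply, Pi.single_apply, Finset.sum_filter,
      eq_comm]

/-- The `M`-component involves only the coefficients of the `u_k`, and the `ℤ ^ r`-component then
determines those of the `e_j`. So relations and generation reduce to the rays `v_k`. -/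
theorem isPrimitiveCircuit_cayleySet (hw : ∀ k, 0 < w k) (hgcd : Finset.univ.gcd w = 1)
    (hgen : Submodule.span ℤ (Set.range v) = ⊤) (hrel : ∑ k, (w k : ℤ) • v k = 0)
    (hp : Function.Surjective p) (hbij : Function.Bijective (cayleyPoint v p)) :
    IsPrimitiveCircuit (cayleySet v p) (cayleyRelation w hbij) where
  nonempty := ⟨cayleyPoint v p (Sum.inr 0)⟩
  ne_zero ω := by
    obtain ⟨j | k, rfl⟩ := hbij.2 ω
    · simpa using (partDegree_pos hw hp j).ne'
    · simpa using (hw k).ne'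
  sum_eq_zero := by
    rw [sum_cayleySet hbij]
    simp only [cayleyRelation_inl, cayleyRelation_inr, Finset.sum_neg_distrib]
    exact_mod_cast neg_add_eq_zero.2 (congrArg (Nat.cast : ℕ → ℤ) (sum_partDegree w p))
  relation := by
    rw [sum_smul_cayleySet_apply hbij]
    simp only [cayleyRelation_inl, cayleyRelation_inr, hrel]
    ext (i | j) <;> simp [partDegree]
  unique z hz := by
    rw [sum_smul_cayleySet_apply hbij] at hz
    obtain ⟨c, hc⟩ := exists_eq_mul_weights hw hgcd hgen hrel
      (fun k => z (cayleyPoint v p (Sum.inr k))) (funext fun i => congrFun hz (Sum.inl i))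
    refine ⟨c, fun ω => ?_⟩
    obtain ⟨j | k, rfl⟩ := hbij.2 ω
    · have := congrFun hz (Sum.inr j)
      simp only [Sum.elim_inr, hc, ← Finset.mul_sum, Pi.zero_apply] at this
      rw [cayleyRelation_inl, partDegree]
      push_cast
      linear_combination this
    · rw [cayleyRelation_inr, hc]
  generates y := by
    have hy : (fun i => y (Sum.inl i)) ∈ Submodule.span ℤ (Set.range v) := hgen ▸ trivial
    obtain ⟨c, hc⟩ := (Submodule.mem_span_range_iff_exists_fun ℤ).1 hy
    refine ⟨fun ω => Sum.elim (fun j => y (Sum.inr j) - ∑ k with p k = j, c k) c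
      ((Equiv.ofBijective _ hbij).symm ω), ?_⟩
    rw [sum_smul_cayleySet_apply hbij]
    simp only [Equiv.ofBijective_symm_apply_apply, Sum.elim_inl, Sum.elim_inr, hc]
    ext (i | j) <;> simp

theorem triangulationU_eq (hw : ∀ k, 0 < w k) (hbij : Function.Bijective (cayleyPoint v p)) :
    triangulationU v p = positiveTriangulation (cayleyRelation w hbij) := by
  ext S
  constructor
  · rintro ⟨k, rfl⟩
    exact ⟨cayleyPoint v p (Sum.inr k), by simpa using hw k,
      Set.ext fun _ => not_congr ⟨fun he => Subtype.ext he, congrArg Subtype.val⟩⟩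
  · rintro ⟨ω, hω, rfl⟩
    obtain ⟨j | k, rfl⟩ := hbij.2 ω
    · rw [cayleyRelation_inl] at hω
      omega
    · exact ⟨k, Set.ext fun _ => not_congr ⟨fun he => Subtype.ext he, congrArg Subtype.val⟩⟩

theorem triangulationE_eq (hw : ∀ k, 0 < w k) (hp : Function.Surjective p)
    (hbij : Function.Bijective (cayleyPoint v p)) :
    triangulationE v p = positiveTriangulation (-cayleyRelation w hbij) := by
  ext S
  constructor
  · rintro ⟨j, rfl⟩
    exact ⟨cayleyPoint v p (Sum.inl j), by simpa using partDegree_pos hw hp j,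
      Set.ext fun _ => not_congr ⟨fun he => Subtype.ext he, congrArg Subtype.val⟩⟩
  · rintro ⟨ω, hω, rfl⟩
    obtain ⟨j | k, rfl⟩ := hbij.2 ω
    · exact ⟨j, Set.ext fun _ => not_congr ⟨fun he => Subtype.ext he, congrArg Subtype.val⟩⟩
    · rw [Pi.neg_apply, cayleyRelation_inr] at hω
      omega

theorem cayleyPolynomial_eq_sum (v : Fin (d + 1) → Fin d → ℤ) (p : Fin (d + 1) → Fin r)
    (a : Fin (d + 1) → ℂ) : cayleyPolynomial v p a =
      ∑ x, AddMonoidAlgebra.single (cayleyPoint v p x).1 (Sum.elim (fun _ => 1) (-a) x) := by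
  have hE : ∀ j : Fin r, (cayleyE d j + Sum.elim (0 : Fin d → ℤ) (0 : Fin r → ℤ)) = cayleyE d j := by
    intro j
    ext (i | i) <;> simp
  have hU : ∀ k, cayleyE d (p k) + Sum.elim (v k) (0 : Fin r → ℤ) = cayleyU v p k := by
    intro k
    ext (i | i) <;>
      simp only [cayleyE, cayleyU, Pi.add_apply, Sum.elim_inl, Sum.elim_inr, Pi.zero_apply,
        zero_add, add_zero]
  have h1 : ∀ j : Fin r, AddMonoidAlgebra.single (cayleyE d j) (1 : ℂ) *
      AddMonoidAlgebra.mapDomain (fun m : Fin d → ℤ => Sum.elim m (0 : Fin r → ℤ))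
        (cayleyF v p a j) = AddMonoidAlgebra.single (cayleyE d j) (1 : ℂ) -
          ∑ k with p k = j, AddMonoidAlgebra.single (cayleyU v p k) (a k) := by
    intro j
    rw [cayleyF, ← AddMonoidHom.mk'_apply (AddMonoidAlgebra.mapDomain _)
      (AddMonoidAlgebra.mapDomain_add _), map_sub, map_sum, AddMonoidAlgebra.one_def, mul_sub,
      Finset.mul_sum]
    simp only [AddMonoidHom.mk'_apply, AddMonoidAlgebra.mapDomain_single,
      AddMonoidAlgebra.single_mul_single, one_mul, hE]
    congr 1
    refine Finset.sum_congr rfl fun k hk => ?_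
    rw [← hU, (Finset.mem_filter.1 hk).2]
  rw [cayleyPolynomial, Finset.sum_congr rfl fun j _ => h1 j, Finset.sum_sub_distrib,
    Finset.sum_fiberwise, Fintype.sum_sum_type, sub_eq_add_neg, ← Finset.sum_neg_distrib]
  congr 1
  refine Finset.sum_congr rfl fun k _ => ?_
  rw [Sum.elim_inr, Pi.neg_apply, AddMonoidAlgebra.single_neg]
  rfl

theorem coeffsOn_cayleyPolynomial (hbij : Function.Bijective (cayleyPoint v p))
    (a : Fin (d + 1) → ℂ) (x : Fin r ⊕ Fin (d + 1)) :
    coeffsOn (cayleySet v p) (cayleyPolynomial v p a) (cayleyPoint v p x) =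
      Sum.elim (fun _ => 1) (-a) x := by
  rw [coeffsOn, cayleyPolynomial_eq_sum, AddMonoidAlgebra.coeff_sum, Finsupp.finsetSum_apply,
    Finset.sum_eq_single x]
  · simp
  · intro y _ hyx
    rw [AddMonoidAlgebra.coeff_single]
    exact Finsupp.single_eq_of_ne fun he => hyx (hbij.1 (Subtype.ext he)).symm
  · simp

theorem prod_coeffsOn_pow_posExponent (hbij : Function.Bijective (cayleyPoint v p))
    (a : Fin (d + 1) → ℂ) :
    ∏ ω, coeffsOn (cayleySet v p) (cayleyPolynomial v p a) ω ^
      posExponent (cayleyRelation w hbij) ω = (-1) ^ (∑ k, w k) * ∏ k, a k ^ w k := by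
  rw [prod_cayleySet hbij]
  simp [coeffsOn_cayleyPolynomial hbij, neg_pow (a _), Finset.prod_mul_distrib,
    Finset.prod_pow_eq_pow_sum]

theorem prod_coeffsOn_pow_posExponent_neg (hbij : Function.Bijective (cayleyPoint v p))
    (a : Fin (d + 1) → ℂ) :
    ∏ ω, coeffsOn (cayleySet v p) (cayleyPolynomial v p a) ω ^
      posExponent (-cayleyRelation w hbij) ω = 1 := by
  rw [prod_cayleySet hbij]
  simp [coeffsOn_cayleyPolynomial hbij]

theorem prod_cayleyRelation_pow_posExponent (hbij : Function.Bijective (cayleyPoint v p)) :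
    ∏ ω, cayleyRelation w hbij ω ^ posExponent (cayleyRelation w hbij) ω =
      ((∏ k, w k ^ w k : ℕ) : ℤ) := by
  rw [prod_cayleySet hbij]
  simp

theorem prod_cayleyRelation_pow_posExponent_neg (hbij : Function.Bijective (cayleyPoint v p)) :
    ∏ ω, cayleyRelation w hbij ω ^ posExponent (-cayleyRelation w hbij) ω =
      (-1) ^ (∑ k, w k) * ((∏ j, partDegree w p j ^ partDegree w p j : ℕ) : ℤ) := by
  rw [prod_cayleySet hbij]
  simp [neg_pow (partDegree w p _ : ℤ), Finset.prod_mul_distrib, Finset.prod_pow_eq_pow_sum,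
    sum_partDegree]

/-- Split `d_j ^ d_j` as the product of `d_j ^ w_k` over the `k` in the `j`-th part and compare
factors. -/
theorem prod_pow_dvd_prod_partDegree_pow (hdvd : ∀ k j, w k ∣ partDegree w p j) :
    ∏ k, w k ^ w k ∣ ∏ j, partDegree w p j ^ partDegree w p j := by
  rw [← Finset.prod_fiberwise _ p]
  refine Finset.prod_dvd_prod_of_dvd _ _ fun j _ => ?_
  conv_rhs => rw [partDegree, ← Finset.prod_pow_eq_pow_sum]
  exact Finset.prod_dvd_prod_of_dvd _ _ fun k _ => pow_dvd_pow_of_dvd (hdvd k j) _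

end WeightedProjectiveSpace

theorem mem_support_C_mul_circuitBinomial {σ : Type*} {A : Finset (σ → ℤ)} {κ : A → ℤ}
    (h : IsPrimitiveCircuit A κ) {a b : ℤ} (ha : a ≠ 0) (hb : b ≠ 0) (ε : ℤˣ)
    (m : A →₀ ℕ) : m ∈ (C (ε : ℤ) * circuitBinomial ℤ κ a b).support ↔
      m = posExponent κ ∨ m = posExponent (-κ) := by
  rw [mem_support_iff, coeff_C_mul, Ne, mul_eq_zero, not_or]
  refine ⟨fun ⟨_, hm⟩ => ?_, ?_⟩
  · classical
    by_contra! hne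
    exact hm (by simp [circuitBinomial, coeff_monomial, hne.1.symm, hne.2.symm])
  · rintro (rfl | rfl)
    · exact ⟨ε.ne_zero, by rwa [(coeff_circuitBinomial h a b).1]⟩
    · exact ⟨ε.ne_zero, by rwa [(coeff_circuitBinomial h a b).2, neg_eq_zero]⟩

end

theorem mainTheorem6 (d r : ℕ) (hd : 0 < d)
    (w : Fin (d + 1) → ℕ) (v : Fin (d + 1) → Fin d → ℤ) (p : Fin (d + 1) → Fin r)
    (hw : ∀ k, 0 < w k) (hgcd : Finset.univ.gcd w = 1)
    (hgen : Submodule.span ℤ (Set.range v) = ⊤)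
    (hrel : ∑ k, (w k : ℤ) • v k = 0)
    (hp : Function.Surjective p)
    (g : ℕ) (hg : g = Nat.gcd (∏ k, w k ^ w k) (∏ j, partDegree w p j ^ partDegree w p j)) :
    (∃ ε : ℤˣ,
      (∀ a : Fin (d + 1) → ℂ,
        (g : ℂ) * aDiscriminantOf (cayleySet v p) (cayleyPolynomial v p a) =
          ((ε : ℤ) : ℂ) * (∏ k, (w k : ℂ) ^ w k -
            (∏ j, (partDegree w p j : ℂ) ^ partDegree w p j) * ∏ k, a k ^ w k)) ∧
      (∃ m : cayleySet v p →₀ ℕ,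
        CorrespondsToTriangulation (cayleySet v p) (aDiscriminant (cayleySet v p)) m
          (triangulationU v p) ∧
        ∀ a : Fin (d + 1) → ℂ,
          (g : ℂ) * MvPolynomial.aeval (coeffsOn (cayleySet v p) (cayleyPolynomial v p a))
              (MvPolynomial.monomial m ((aDiscriminant (cayleySet v p)).coeff m)) =
            ((ε : ℤ) : ℂ) * ∏ k, (w k : ℂ) ^ w k) ∧
      (∃ m : cayleySet v p →₀ ℕ,
        CorrespondsToTriangulation (cayleySet v p) (aDiscriminant (cayleySet v p)) m
          (triangulationE v p) ∧
        ∀ a : Fin (d + 1) → ℂ,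
          (g : ℂ) * MvPolynomial.aeval (coeffsOn (cayleySet v p) (cayleyPolynomial v p a))
              (MvPolynomial.monomial m ((aDiscriminant (cayleySet v p)).coeff m)) =
            -(((ε : ℤ) : ℂ) * ((∏ j, (partDegree w p j : ℂ) ^ partDegree w p j) *
              ∏ k, a k ^ w k)))) ∧
    (∀ a : Fin (d + 1) → ℂ,
      ∏ k, (w k : ℂ) ^ w k -
          (∏ j, (partDegree w p j : ℂ) ^ partDegree w p j) * ∏ k, a k ^ w k =
        (∏ k, (w k : ℂ) ^ w k) *
          (1 - ((∏ j, (partDegree w p j : ℂ) ^ partDegree w p j) / ∏ k, (w k : ℂ) ^ w k) *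
            ∏ k, a k ^ w k)) ∧
    ((∀ k j, w k ∣ partDegree w p j) → g = ∏ k, w k ^ w k) := by
  have hW : (∏ k, (w k : ℂ) ^ w k) ≠ 0 :=
    Finset.prod_ne_zero_iff.2 fun k _ => pow_ne_zero _ (Nat.cast_ne_zero.2 (hw k).ne')
  refine ⟨?_, fun a => ?_, fun hdvd => ?_⟩
  · have hbij : Function.Bijective (cayleyPoint v p) :=
      cayleyPoint_bijective hd hw hgcd hgen hrel
    have h := isPrimitiveCircuit_cayleySet hw hgcd hgen hrel hp hbij
    set κ := cayleyRelation w hbij with hκ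
    set W := ∏ k, w k ^ w k with hWdef
    set Δ := ∏ j, partDegree w p j ^ partDegree w p j with hΔdef
    have hWpos : 0 < W := Finset.prod_pos fun k _ => pow_pos (hw k) _
    have hΔpos : 0 < Δ := Finset.prod_pos fun j _ => pow_pos (partDegree_pos hw hp j) _
    obtain ⟨W', Δ', hcop, hW', hΔ'⟩ := Nat.exists_coprime W Δ
    rw [← hg] at hW' hΔ'
    have hW'0 : (W' : ℤ) ≠ 0 := by
      rintro h0
      rw [Nat.cast_eq_zero.1 h0, zero_mul] at hW'
      omega
    have hΔ'0 : (Δ' : ℤ) ≠ 0 := by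
      rintro h0
      rw [Nat.cast_eq_zero.1 h0, zero_mul] at hΔ'
      omega
    -- The sign comes from the entries `-d_j` of `κ`, as `∑ d_j = ∑ w_k`; it cancels against the one
    -- from the coefficients `-a_k` of `F`.
    set s : ℤˣ := (-1) ^ ∑ k, w k with hs
    have hsval : (s : ℤ) = (-1) ^ ∑ k, w k := by simp [hs]
    have hss : ((s : ℤ) : ℂ) * (-1) ^ ∑ k, w k = 1 := by
      rw [hsval]
      push_cast
      rw [← mul_pow]
      simp
    have ha : (s : ℤ) * Δ' ≠ 0 := mul_ne_zero s.ne_zero hΔ'0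
    have hab : (s : ℤ) * Δ' * ∏ ω, κ ω ^ posExponent κ ω =
        W' * ∏ ω, κ ω ^ posExponent (-κ) ω := by
      rw [hκ, prod_cayleyRelation_pow_posExponent, prod_cayleyRelation_pow_posExponent_neg,
        ← hsval, ← hWdef, ← hΔdef, hW', hΔ']
      push_cast
      ring
    have hcop' : IsCoprime ((s : ℤ) * Δ') (W' : ℤ) :=
      (isCoprime_mul_unit_left_left s.isUnit _ _).2 (Nat.isCoprime_iff_coprime.2 hcop.symm)
    obtain ⟨ε, hε⟩ := h.aDiscriminant_eq ha hcop' hab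
    have hsupp := mem_support_C_mul_circuitBinomial h ha hW'0 ε
    have hWC : (∏ k, (w k : ℂ) ^ w k) = W' * g := by exact_mod_cast hW'
    have hΔC : (∏ j, (partDegree w p j : ℂ) ^ partDegree w p j) = Δ' * g := by exact_mod_cast hΔ'
    obtain ⟨hc₁, hc₂⟩ := coeff_circuitBinomial h ((s : ℤ) * Δ') W'
    rw [hε]
    -- The summand `∏ w_k ^ w_k` comes from the subtracted term `W' x ^ κ⁻`, hence the sign `-ε`.
    refine ⟨-ε, fun a => ?_, ⟨posExponent (-κ), ?_, fun a => ?_⟩, ⟨posExponent κ, ?_, fun a => ?_⟩⟩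
    · rw [aDiscriminantOf, hε, map_mul, aeval_C, aeval_circuitBinomial,
        prod_coeffsOn_pow_posExponent, prod_coeffsOn_pow_posExponent_neg, hWC, hΔC]
      simp only [eq_intCast, Units.val_neg]
      push_cast
      linear_combination (g * (ε : ℤ) * Δ' * ∏ k, a k ^ w k : ℂ) * hss
    · rw [triangulationU_eq hw hbij]
      exact h.correspondsToTriangulation hsupp
    · rw [coeff_C_mul, hc₂, aeval_monomial, Finsupp.prod_fintype _ _ (by simp),
        prod_coeffsOn_pow_posExponent_neg, hWC]
      simp only [eq_intCast, Units.val_neg]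
      push_cast
      ring
    · rw [triangulationE_eq hw hp hbij]
      -- Passing to `-κ` exchanges the two exponents and the two triangulations.
      have := h.neg.correspondsToTriangulation
        (D := C (ε : ℤ) * circuitBinomial ℤ κ ((s : ℤ) * Δ') W')
        (fun m => by rw [hsupp, neg_neg, or_comm])
      rwa [neg_neg] at this
    · rw [coeff_C_mul, hc₁, aeval_monomial, Finsupp.prod_fintype _ _ (by simp),
        prod_coeffsOn_pow_posExponent, hΔC]
      simp only [eq_intCast, Units.val_neg]
      push_cast
      linear_combination (g * (ε : ℤ) * Δ' * ∏ k, a k ^ w k : ℂ) * hss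
  · field_simp
  · rw [hg]
    exact Nat.gcd_eq_left (prod_pow_dvd_prod_partDegree_pow hdvd)
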